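/- **Setting.** Let $\mathcal X$ be a finite set, $P$ a probability mass function on $\mathcal X$, and for every $n\ge 1$ let $\mathcal Q_n$ be a set of probability mass functions on $\mathcal X^n$; write $\mathcal Q=\mathcal Q_1$ and $\mathbb H=(\mathcal X,P,\{\mathcal Q_n\}_n)$. Let $P^{\times n}(x^n)=\prod_i P(x_i)$. For $\mu\ge 0$ let $\hat\alpha(\mu;P^{\times n}\|\mathcal Q_n)$ be the minimum of $\sum_{x^n}P^{\times n}(x^n)(1-T(x^n))$ over all tests $T:\mathcal X^n\to[0,1]$ with $\sup_{Q\in\mathcal Q_n}\sum_{x^n}Q(x^n)T(x^n)\le\mu$, and define the error exponent $$\mathrm e_R(\mathbb H)=\liminf_{n\to\infty}-\tfrac1n\log\hat\alpha\big(\exp(-nR);P^{\times n}\big\|\mathcal Q_n\big)\in[0,\infty],\qquad -\log 0=+\infty .$$ For $s>0$, $s\ne1$, let $g_s(P\|Q)=\sum_{x:P(x)>0}P(x)^sQ(x)^{1-s}\in[0,\infty]$ and $D_s(P\|Q)=\frac{1}{s-1}\log g_s(P\|Q)$ (Rényi divergence), let $D_1(P\|Q)=\sum_xP(x)\log\frac{P(x)}{Q(x)}$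 (equal to $+\infty$ if $P\not\ll Q$) be the Kullback–Leibler divergence, and let $D_s(P\|\mathcal Q)=\inf_{Q\in\mathcal Q}D_s(P\|Q)$. **Hypotheses.** Let $0\le a<1$ and assume the following, on the interval of orders $(a,1]$. * (Product) $Q^{\times n}\in\mathcal Q_n$ for all $Q\in\mathcal Q$ and $n\ge 1$. * (Additivity) $D_s(P^{\times n}\|\mathcal Q_n)\ge n\,D_s(P\|\mathcal Q)$ for all $s\in(a,1]$ and $n\ge1$. * (Universal distribution) There are permutation invariant probability mass functions $U^n$ on $\mathcal X^n$ and a polynomial $v$ such that, for all $n\ge 1$, every permutation invariant $Q\in\mathcal Q_n$ satisfies $Q\le v(n)\,U^n$ pointwise, and $D_s(P^{\times n}\|U^n)\ge D_s(P^{\times n}\|\mathcal Q_n)$ for all $s\in(a,1]$. Moreover, $\mathcal Q_n$ is closed under symmetrization, i.e. under averaging over all permutations of the $n$ coordinates. * (Convex parametrization) There are a compact convex set $\Theta\subset\mathbb R^d$ and a $C^2$ map $\theta\mapsto Q_\theta$ on $\Theta$ with $\mathcal Q=\{Q_\theta:\theta\in\Theta\}$, such that $\theta\mapsto g_s(P\|Q_\theta)$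 is concave on $\Theta$ for all $s\in(a,1)$, and such that for every $s\in(a,1]$ the function $\theta\mapsto D_s(P\|Q_\theta)$ has a unique minimizer on $\Theta$, which lies in the interior of $\Theta$. **Theorem.** For every $R\ge0$, $$\mathrm e_R(\mathbb H)\ \ge\ \sup_{s\in(a,1)}\Big\{\frac{1-s}{s}\big(D_s(P\|\mathcal Q)-R\big)\Big\}.$$ Moreover, let $\phi(s)=(s-1)D_s(P\|\mathcal Q)$ (if $D_s(P\|\mathcal Q)=+\infty$ on $(a,1)$, which happens only when $\mathcal Q$ is a single distribution whose support is disjoint from that of $P$, put $\phi=0$). Then $\phi$ is differentiable on $(a,1)$, the $a$-critical rate $R_a=\lim_{s\downarrow a}\big(s\phi'(s)-\phi(s)\big)$ exists and is finite, and equality holds for every $R\ge 0$ with $R>R_a$. This generalizes Hoeffding's bound to composite alternatives. -/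

import Mathlib

open Filter Topology
open scoped ENNReal

noncomputable section

namespace CompositeTesting

variable {X : Type*}

/-- A sequence of hypothesis testing problems with composite alternative hypothesis on the finite
alphabet `X`: the null hypothesis is `P^{×n}`, the alternative is some element of `Q n`.
Probability mass functions are points of the standard simplex. Only `n ≥ 1` plays a role. -/
structure Problem (X : Type*) [Fintype X] where
  /-- the null distribution -/
  P : X → ℝ
  /-- the sets of alternative distributions on `X^n` -/
  Q : (n : ℕ) → Set ((Fin n → X) → ℝ)
  P_mem : P ∈ stdSimplex ℝ X
  Q_subset : ∀ n, Q n ⊆ stdSimplex ℝ (Fin n → X)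

/-- The i.i.d. product `P^{×n}`. -/
def iid (P : X → ℝ) (n : ℕ) : (Fin n → X) → ℝ := fun x => ∏ i, P (x i)

/-- The base set `𝒬 = 𝒬_1`, with `X^1` identified with `X`. -/
def Problem.base [Fintype X] (H : Problem X) : Set (X → ℝ) :=
  {q | (fun x : Fin 1 → X => q (x 0)) ∈ H.Q 1}

section Tests

variable [Fintype X]

/-- Type-I error probability of the test `T`. -/
def typeI (T P : X → ℝ) : ℝ := ∑ x, P x * (1 - T x)

/-- Worst-case type-II error probability of the test `T` over the set `𝒬`. -/
def typeII (T : X → ℝ) (𝒬 : Set (X → ℝ)) : ℝ := sSup ((fun q => ∑ x, q x * T x) '' 𝒬)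

/-- Minimal type-I error probability among the randomized tests `T : X → [0,1]` whose type-II error
probability is at most `μ`. -/
def alphaHat (μ : ℝ) (P : X → ℝ) (𝒬 : Set (X → ℝ)) : ℝ :=
  sInf {α | ∃ T : X → ℝ, (∀ x, T x ∈ Set.Icc (0 : ℝ) 1) ∧ typeII T 𝒬 ≤ μ ∧ α = typeI T P}

/-- The error exponent `e_R = liminf_n -(1/n) log α̂(exp(-nR); P^{×n} ‖ 𝒬_n)` in `[-∞, ∞]`, with
`log 0 = -∞`. -/
def Problem.errorExponent (H : Problem X) (R : ℝ) : EReal :=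
  liminf (fun n : ℕ =>
    (-ENNReal.log (ENNReal.ofReal (alphaHat (Real.exp (-(n * R))) (iid H.P n) (H.Q n)))) /
      (n : EReal)) atTop

end Tests

section Renyi

variable [Fintype X]

/-- `g_s(P‖Q) = ∑_{P(x) > 0} P(x)^s Q(x)^{1-s}` in `[0, ∞]`; here `0 ^ (1 - s) = ∞` if `s > 1`. -/
def renyiG (s : ℝ) (P Q : X → ℝ) : ℝ≥0∞ :=
  ∑ x with 0 < P x, ENNReal.ofReal (P x) ^ s * ENNReal.ofReal (Q x) ^ (1 - s)

open Classical in
/-- The Kullback-Leibler divergence. -/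
def klDivergence (P Q : X → ℝ) : EReal :=
  if ∀ x, Q x = 0 → P x = 0 then
    ((∑ x, P x * (Real.log (P x) - Real.log (Q x)) : ℝ) : EReal)
  else ⊤

open Classical in
/-- The Rényi divergence `D_s(P‖Q)` of order `s > 0`. -/
def renyiDiv (s : ℝ) (P Q : X → ℝ) : EReal :=
  if s = 1 then klDivergence P Q else ENNReal.log (renyiG s P Q) / ((s - 1 : ℝ) : EReal)

/-- `D_s(P‖𝒬) = inf_{Q ∈ 𝒬} D_s(P‖Q)`. -/
def renyiDivSet (s : ℝ) (P : X → ℝ) (𝒬 : Set (X → ℝ)) : EReal := ⨅ Q ∈ 𝒬, renyiDiv s P Q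

/-- `φ(s) = (s - 1) D_s(P‖𝒬)` as a real function. -/
def phi (P : X → ℝ) (𝒬 : Set (X → ℝ)) (s : ℝ) : ℝ := (s - 1) * (renyiDivSet s P 𝒬).toReal

/-- `ψ(s) = s φ'(s) - φ(s)`. -/
def psi (P : X → ℝ) (𝒬 : Set (X → ℝ)) (s : ℝ) : ℝ := s * deriv (phi P 𝒬) s - phi P 𝒬 s

/-- The `c`-critical rate `R_c = lim ψ(s)` as `s` tends to `c` (from the right, which is the only
side available at the left end point of the interval on which the axioms hold). -/
def criticalRate (P : X → ℝ) (𝒬 : Set (X → ℝ)) (c : ℝ) : ℝ := limUnder (𝓝[>] c) (psi P 𝒬)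

end Renyi

section Symmetry

/-- Permutation invariance of a function on `X^n`. -/
def PermInvariant {n : ℕ} (q : (Fin n → X) → ℝ) : Prop :=
  ∀ (π : Equiv.Perm (Fin n)) (x : Fin n → X), q (fun i => x (π i)) = q x

/-- The permutation invariant elements of a set of distributions on `X^n`. -/
def symPart {n : ℕ} (𝒬 : Set ((Fin n → X) → ℝ)) : Set ((Fin n → X) → ℝ) :=
  {q ∈ 𝒬 | PermInvariant q}

/-- The symmetrization `(1/n!) ∑_π q W[π]`. -/
def symmetrize {n : ℕ} (q : (Fin n → X) → ℝ) : (Fin n → X) → ℝ :=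
  fun x => (n.factorial : ℝ)⁻¹ * ∑ π : Equiv.Perm (Fin n), q (fun i => x (π i))

end Symmetry

section Axioms

variable [Fintype X]

/-- Products: `𝒬_n` contains `Q^{×n}` for every `Q ∈ 𝒬`. -/
def Problem.ProductAxiom (H : Problem X) : Prop :=
  ∀ n : ℕ, 1 ≤ n → ∀ q ∈ H.base, iid q n ∈ H.Q n

/-- Additivity for the orders in `I`. -/
def Problem.AdditivityAxiom (H : Problem X) (I : Set ℝ) : Prop :=
  ∀ s ∈ I, ∀ n : ℕ, 1 ≤ n →
    (n : EReal) * renyiDivSet s H.P H.base ≤ renyiDivSet s (iid H.P n) (H.Q n)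

/-- Universal distribution for the orders in `I`, and closedness under symmetrization. -/
def Problem.UniversalAxiom (H : Problem X) (I : Set ℝ) : Prop :=
  (∃ (U : (n : ℕ) → (Fin n → X) → ℝ) (v : Polynomial ℝ), ∀ n : ℕ, 1 ≤ n →
    U n ∈ stdSimplex ℝ (Fin n → X) ∧ PermInvariant (U n) ∧
    (∀ q ∈ symPart (H.Q n), ∀ x, q x ≤ v.eval (n : ℝ) * U n x) ∧
    ∀ s ∈ I, renyiDivSet s (iid H.P n) (H.Q n) ≤ renyiDiv s (iid H.P n) (U n)) ∧
  ∀ n : ℕ, 1 ≤ n → ∀ q ∈ H.Q n, symmetrize q ∈ symPart (H.Q n)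

/-- Convex parametrization for the orders in `I`: `𝒬 = {Q_θ : θ ∈ Θ}` for a `C²` map on a compact
convex set `Θ ⊆ ℝ^d`, with `θ ↦ g_s(P‖Q_θ)` concave for `s < 1` and convex for `s > 1`, and with a
unique minimizer of `θ ↦ D_s(P‖Q_θ)`, which lies in the interior of `Θ`. -/
def Problem.ConvexParamAxiom (H : Problem X) (I : Set ℝ) : Prop :=
  ∃ (d : ℕ) (Θ : Set (EuclideanSpace ℝ (Fin d))) (Q : EuclideanSpace ℝ (Fin d) → X → ℝ),
    IsCompact Θ ∧ Convex ℝ Θ ∧ ContDiffOn ℝ 2 Q Θ ∧ H.base = Q '' Θ ∧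
    (∀ s ∈ I, s < 1 → ConcaveOn ℝ Θ (fun θ => (renyiG s H.P (Q θ)).toReal)) ∧
    (∀ s ∈ I, 1 < s → ∀ θ ∈ Θ, ∀ θ' ∈ Θ, ∀ t ∈ Set.Icc (0 : ℝ) 1,
      renyiG s H.P (Q (t • θ + (1 - t) • θ')) ≤
        ENNReal.ofReal t * renyiG s H.P (Q θ) + ENNReal.ofReal (1 - t) * renyiG s H.P (Q θ')) ∧
    ∀ s ∈ I, ∃ θ₀ ∈ interior Θ, ∀ θ ∈ Θ, θ ≠ θ₀ →
      renyiDiv s H.P (Q θ₀) < renyiDiv s H.P (Q θ)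

/-- The Hoeffding bound `sup_{s ∈ (a,1)} ((1-s)/s) (D_s(P‖𝒬) - R)`. -/
def Problem.hoeffdingBound (H : Problem X) (a R : ℝ) : EReal :=
  ⨆ s ∈ Set.Ioo a 1, (((1 - s) / s : ℝ) : EReal) * (renyiDivSet s H.P H.base - (R : EReal))

end Axioms

end CompositeTesting

end

/-! Lower bound: test `P^{×n}` against the universal distribution `U n` by a likelihood ratio test.
Such a test is permutation invariant, so its type-II error against `q ∈ Q n` equals that against the
symmetrization of `q`, which is at most `v(n)` times that against `U n`. Both errors are controlled
by the Chernoff sum of `P^{×n}` and `U n`, which additivity bounds by `exp (-(1-s) n D_s(P‖𝒬))`; the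
polynomial factor does not affect the exponent (`Problem.le_errorExponent_of_le_renyiDivSet`).

Upper bound: let `q_s` minimize `D_s(P‖·)` over `𝒬`, let `G` be its Chernoff sum at order `s`, and
`c` the slope of the logarithm of that sum with `q_s` held fixed. Since `q_s^{×n} ∈ Q n`, a converse
for one simple alternative suffices. A change of measure to the tilted distribution `P^s q_s^{1-s} /
G`, with Chebyshev's inequality, shows that `e_R ≤ -log G - (1-s)c` as soon as `ψ(s) = s c - log G <
R` (`eventually_exp_le_typeI`). This value exceeds the Hoeffding expression at `s` by exactly
`(1-s)(R - ψ(s))/s`. For `R > R_a` the excess is made arbitrarily small: by continuity `ψ` comes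
just below `R`, or it stays below `R` and `s` tends to `1` (`exists_order_near`).

Regularity: `φ` is the maximum over `θ` of the convex functions `log (chernoff · P (Q θ))`, so the
slope at a maximizer is a subgradient of `φ`. Compactness and uniqueness make the maximizer
continuous in `s`, hence also the subgradient, and `φ` is differentiable
(`hasDerivAt_of_subgradient`). -/

namespace CompositeTesting

/-! ### The Chernoff sum -/

section Chernoff

variable {X : Type*} [Fintype X]

/-- The Chernoff sum `∑ₓ P(x)^s Q(x)^{1-s}` as a real number, for `0 < s < 1`. -/
noncomputable def chernoff (s : ℝ) (P Q : X → ℝ) : ℝ := ∑ x, P x ^ s * Q x ^ (1 - s)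

/-- The derivative of the Chernoff sum in `s`. -/
noncomputable def chernoffDeriv (s : ℝ) (P Q : X → ℝ) : ℝ :=
  ∑ x, P x ^ s * Q x ^ (1 - s) * (Real.log (P x) - Real.log (Q x))

lemma chernoff_nonneg {P Q : X → ℝ} (hP : 0 ≤ P) (hQ : 0 ≤ Q) (s : ℝ) : 0 ≤ chernoff s P Q :=
  Finset.sum_nonneg fun x _ => mul_nonneg (Real.rpow_nonneg (hP x) _) (Real.rpow_nonneg (hQ x) _)

lemma renyiG_eq_ofReal {P Q : X → ℝ} (hP : 0 ≤ P) (hQ : 0 ≤ Q) {s : ℝ} (hs : s ∈ Set.Ioo (0 : ℝ) 1) :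
    renyiG s P Q = ENNReal.ofReal (chernoff s P Q) := by
  unfold renyiG chernoff
  rw [ENNReal.ofReal_sum_of_nonneg fun x _ =>
    mul_nonneg (Real.rpow_nonneg (hP x) _) (Real.rpow_nonneg (hQ x) _), Finset.sum_filter]
  refine Finset.sum_congr rfl fun x _ => ?_
  have h1 : (0 : ℝ) ≤ 1 - s := by linarith [hs.2]
  rw [ENNReal.ofReal_mul (Real.rpow_nonneg (hP x) _),
    ENNReal.ofReal_rpow_of_nonneg (hP x) hs.1.le, ENNReal.ofReal_rpow_of_nonneg (hQ x) h1]
  split_ifs with h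
  · rfl
  · have : P x = 0 := le_antisymm (not_lt.mp h) (hP x)
    simp [this, Real.zero_rpow hs.1.ne']

lemma renyiDiv_eq {P Q : X → ℝ} (hP : 0 ≤ P) (hQ : 0 ≤ Q) {s : ℝ} (hs : s ∈ Set.Ioo (0 : ℝ) 1) :
    renyiDiv s P Q = ENNReal.log (ENNReal.ofReal (chernoff s P Q)) / ((s - 1 : ℝ) : EReal) := by
  rw [renyiDiv, if_neg hs.2.ne, renyiG_eq_ofReal hP hQ hs]

lemma renyiDiv_of_pos {P Q : X → ℝ} (hP : 0 ≤ P) (hQ : 0 ≤ Q) {s : ℝ} (hs : s ∈ Set.Ioo (0 : ℝ) 1)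
    (h : 0 < chernoff s P Q) :
    renyiDiv s P Q = ((Real.log (chernoff s P Q) / (s - 1) : ℝ) : EReal) := by
  rw [renyiDiv_eq hP hQ hs, ENNReal.log_ofReal_of_pos h, EReal.coe_div]

lemma renyiDiv_of_eq_zero {P Q : X → ℝ} (hP : 0 ≤ P) (hQ : 0 ≤ Q) {s : ℝ}
    (hs : s ∈ Set.Ioo (0 : ℝ) 1) (h : chernoff s P Q = 0) : renyiDiv s P Q = ⊤ := by
  rw [renyiDiv_eq hP hQ hs, h, ENNReal.ofReal_zero, ENNReal.log_zero]
  refine EReal.bot_div_of_neg_ne_bot ?_ (EReal.coe_ne_bot _)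
  exact_mod_cast (by linarith [hs.2] : s - 1 < 0)

lemma renyiDiv_le_renyiDiv {P Q Q' : X → ℝ} (hP : 0 ≤ P) (hQ : 0 ≤ Q) (hQ' : 0 ≤ Q') {s : ℝ}
    (hs : s ∈ Set.Ioo (0 : ℝ) 1) (h : chernoff s P Q ≤ chernoff s P Q') :
    renyiDiv s P Q' ≤ renyiDiv s P Q := by
  rw [renyiDiv_eq hP hQ hs, renyiDiv_eq hP hQ' hs]
  refine EReal.div_le_div_right_of_nonpos ?_ (ENNReal.log_le_log (ENNReal.ofReal_le_ofReal h))
  exact_mod_cast (by linarith [hs.2] : s - 1 ≤ 0)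

lemma chernoff_le_exp_of_le_renyiDiv {P Q : X → ℝ} (hP : 0 ≤ P) (hQ : 0 ≤ Q) {s r : ℝ}
    (hs : s ∈ Set.Ioo (0 : ℝ) 1) (h : (r : EReal) ≤ renyiDiv s P Q) :
    chernoff s P Q ≤ Real.exp (-((1 - s) * r)) := by
  rcases (chernoff_nonneg hP hQ s).eq_or_lt with h0 | h0
  · rw [← h0]; positivity
  · rw [renyiDiv_of_pos hP hQ hs h0, EReal.coe_le_coe_iff, le_div_iff_of_neg (by linarith [hs.2])] at h
    rw [← Real.log_le_iff_le_exp h0]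
    linarith

end Chernoff

/-! ### Tests -/

section Tests

variable {X : Type*} [Fintype X]

lemma sum_mul_le_one {q T : X → ℝ} (hq : q ∈ stdSimplex ℝ X) (hT : ∀ x, T x ∈ Set.Icc (0 : ℝ) 1) :
    ∑ x, q x * T x ≤ 1 :=
  (Finset.sum_le_sum fun x _ => mul_le_of_le_one_right (hq.1 x) (hT x).2).trans hq.2.le

lemma alphaHat_le {P T : X → ℝ} {𝒬 : Set (X → ℝ)} {μ : ℝ} (hP : 0 ≤ P) (hμ : 0 ≤ μ)
    (hT : ∀ x, T x ∈ Set.Icc (0 : ℝ) 1) (h : ∀ q ∈ 𝒬, ∑ x, q x * T x ≤ μ) :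
    alphaHat μ P 𝒬 ≤ typeI T P := by
  refine csInf_le ⟨0, ?_⟩ ⟨T, hT, Real.sSup_le ?_ hμ, rfl⟩
  · rintro _ ⟨T', hT', -, rfl⟩
    exact Finset.sum_nonneg fun x _ => mul_nonneg (hP x) (by linarith [(hT' x).2])
  · rintro _ ⟨q, hq, rfl⟩
    exact h q hq

lemma le_alphaHat {P q : X → ℝ} {𝒬 : Set (X → ℝ)} {μ c : ℝ} (hμ : 0 ≤ μ)
    (h𝒬 : 𝒬 ⊆ stdSimplex ℝ X) (hq : q ∈ 𝒬)
    (h : ∀ T : X → ℝ, (∀ x, T x ∈ Set.Icc (0 : ℝ) 1) → ∑ x, q x * T x ≤ μ → c ≤ typeI T P) :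
    c ≤ alphaHat μ P 𝒬 := by
  refine le_csInf ⟨typeI 0 P, 0, fun x => ⟨le_rfl, zero_le_one⟩, Real.sSup_le ?_ hμ, rfl⟩ ?_
  · rintro _ ⟨q, -, rfl⟩
    simpa using hμ
  · rintro _ ⟨T, hT, hμT, rfl⟩
    have hbdd : BddAbove ((fun q => ∑ x, q x * T x) '' 𝒬) :=
      ⟨1, by rintro _ ⟨q', hq', rfl⟩; exact sum_mul_le_one (h𝒬 hq') hT⟩
    exact h T hT ((le_csSup hbdd ⟨q, hq, rfl⟩).trans hμT)

/-- One-shot bounds for the likelihood ratio test with threshold `exp L`. -/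
lemma exists_likelihoodRatioTest {P U : X → ℝ} (hP : 0 ≤ P) (hU : 0 ≤ U) {s : ℝ}
    (hs : s ∈ Set.Ioo (0 : ℝ) 1) (L : ℝ) :
    ∃ T : X → ℝ, (∀ x, T x ∈ Set.Icc (0 : ℝ) 1) ∧ (∀ x y, P x = P y → U x = U y → T x = T y) ∧
      typeI T P ≤ Real.exp ((1 - s) * L) * chernoff s P U ∧
      ∑ x, U x * T x ≤ Real.exp (-(s * L)) * chernoff s P U := by
  classical
  -- The test depends on `x` only through `P x` and `U x`, so it inherits their symmetries. In both
  -- error bounds, one factor of `P = P^s P^{1-s}` or `U = U^s U^{1-s}` is replaced by means of the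
  -- threshold inequality.
  refine ⟨fun x => if Real.exp L * U x ≤ P x then 1 else 0, fun x => ?_, fun x y h1 h2 => ?_, ?_, ?_⟩
  · dsimp only; split_ifs <;> simp
  · simp only [h1, h2]
  · rw [typeI, chernoff, Finset.mul_sum]
    refine Finset.sum_le_sum fun x _ => ?_
    have hPs := Real.rpow_nonneg (hP x) s
    have hUs := Real.rpow_nonneg (hU x) (1 - s)
    split_ifs with h
    · simp only [sub_self, mul_zero]; positivity
    · push Not at h
      calc P x * (1 - 0) = P x ^ s * P x ^ (1 - s) := by
            rw [← Real.rpow_add_of_nonneg (hP x) hs.1.le (by linarith [hs.2])]; simp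
        _ ≤ P x ^ s * (Real.exp L * U x) ^ (1 - s) := by
            gcongr
            · exact hP x
            · linarith [hs.2]
        _ = _ := by
            rw [Real.mul_rpow (Real.exp_pos _).le (hU x), ← Real.exp_mul]; ring_nf
  · rw [chernoff, Finset.mul_sum]
    refine Finset.sum_le_sum fun x _ => ?_
    have hPs := Real.rpow_nonneg (hP x) s
    have hUs := Real.rpow_nonneg (hU x) (1 - s)
    dsimp only
    split_ifs with h
    · calc U x * 1 = U x ^ s * U x ^ (1 - s) := by
            rw [← Real.rpow_add_of_nonneg (hU x) hs.1.le (by linarith [hs.2])]; simp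
        _ = Real.exp (-(s * L)) * (Real.exp L * U x) ^ s * U x ^ (1 - s) := by
            rw [Real.mul_rpow (Real.exp_pos _).le (hU x), ← Real.exp_mul, ← mul_assoc,
              ← Real.exp_add]
            ring_nf; simp
        _ ≤ Real.exp (-(s * L)) * P x ^ s * U x ^ (1 - s) := by
            have := mul_nonneg (Real.exp_pos L).le (hU x)
            have := hs.1.le
            gcongr
        _ = _ := by ring
    · simp only [mul_zero]; positivity

/-- Reindexing by a permutation moves it from `q` to `T`, which does not see it. This is how
domination of the symmetric alternatives alone controls every alternative. -/
lemma sum_symmetrize_mul {n : ℕ} (q T : (Fin n → X) → ℝ) (hT : PermInvariant T) :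
    ∑ x, symmetrize q x * T x = ∑ x, q x * T x := by
  have key : ∀ π : Equiv.Perm (Fin n), ∑ x : Fin n → X, q (fun i => x (π i)) * T x =
      ∑ x, q x * T x := fun π => by
    rw [← Equiv.sum_comp (Equiv.arrowCongr π.symm (Equiv.refl X)) fun x => q x * T x]
    refine Finset.sum_congr rfl fun x _ => ?_
    have : (Equiv.arrowCongr π.symm (Equiv.refl X)) x = fun i => x (π i) := by
      ext i; simp [Equiv.arrowCongr]
    rw [this, hT π x]
  simp only [symmetrize, mul_assoc, Finset.sum_mul]
  rw [← Finset.mul_sum, Finset.sum_comm]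
  simp only [key, Finset.sum_const, Finset.card_univ, Fintype.card_perm, Fintype.card_fin,
    nsmul_eq_mul]
  rw [inv_mul_cancel_left₀ (by exact_mod_cast n.factorial_ne_zero)]

end Tests

section

variable {X : Type*}

lemma iid_nonneg {P : X → ℝ} (hP : 0 ≤ P) (n : ℕ) : 0 ≤ iid P n :=
  fun x => Finset.prod_nonneg fun i _ => hP (x i)

lemma permInvariant_iid (P : X → ℝ) (n : ℕ) : PermInvariant (iid P n) :=
  fun π x => Equiv.prod_comp π fun i => P (x i)

end

/-! ### Extended real bookkeeping for exponents -/

lemma le_neg_log_div {α b : ℝ} {n : ℕ} (hn : 1 ≤ n) (h : α ≤ Real.exp (-(n * b))) :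
    (b : EReal) ≤ -ENNReal.log (ENNReal.ofReal α) / (n : EReal) := by
  rw [EReal.le_div_iff_mul_le (by exact_mod_cast hn) (EReal.natCast_ne_top n), EReal.le_neg]
  refine (ENNReal.log_le_log (ENNReal.ofReal_le_ofReal h)).trans ?_
  rw [ENNReal.log_ofReal_of_pos (Real.exp_pos _), Real.log_exp, mul_comm]
  push_cast
  simp

lemma neg_log_div_le {α b : ℝ} {n : ℕ} (hn : 1 ≤ n) (h : Real.exp (-(n * b)) ≤ α) :
    -ENNReal.log (ENNReal.ofReal α) / (n : EReal) ≤ b := by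
  rw [EReal.div_le_iff_le_mul (by exact_mod_cast hn) (EReal.natCast_ne_top n), EReal.neg_le]
  refine le_trans ?_ (ENNReal.log_le_log (ENNReal.ofReal_le_ofReal h))
  rw [ENNReal.log_ofReal_of_pos (Real.exp_pos _), Real.log_exp]
  push_cast
  simp

lemma EReal_coe_le_of_forall_sub_le {b : ℝ} {e : EReal}
    (h : ∀ ε : ℝ, 0 < ε → ((b - ε : ℝ) : EReal) ≤ e) : (b : EReal) ≤ e := by
  refine le_of_forall_lt fun c hc => ?_
  obtain ⟨x, hcx, hxb⟩ := EReal.lt_iff_exists_real_btwn.mp hc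
  have := h (b - x) (sub_pos.mpr (EReal.coe_lt_coe_iff.mp hxb))
  rw [sub_sub_cancel] at this
  exact hcx.trans_le this

lemma EReal_le_coe_of_forall_le_add {b : ℝ} {e : EReal}
    (h : ∀ ε : ℝ, 0 < ε → e ≤ ((b + ε : ℝ) : EReal)) : e ≤ b := by
  refine le_of_forall_gt fun c hc => ?_
  obtain ⟨x, hbx, hxc⟩ := EReal.lt_iff_exists_real_btwn.mp hc
  have := h (x - b) (sub_pos.mpr (EReal.coe_lt_coe_iff.mp hbx))
  rw [add_sub_cancel] at this
  exact this.trans_lt hxc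

lemma eventually_eval_le_exp (v : Polynomial ℝ) {ε : ℝ} (hε : 0 < ε) :
    ∀ᶠ n : ℕ in atTop, v.eval (n : ℝ) ≤ Real.exp (n * ε) := by
  have h := ((v.comp (Polynomial.C ε⁻¹ * Polynomial.X)).tendsto_div_exp_atTop).comp
    ((tendsto_natCast_atTop_atTop (R := ℝ)).atTop_mul_const hε)
  filter_upwards [h.eventually (gt_mem_nhds zero_lt_one)] with n hn
  have e : ε⁻¹ * (n * ε) = n := by field_simp
  simp only [Function.comp_apply, Polynomial.eval_comp, Polynomial.eval_mul, Polynomial.eval_C,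
    Polynomial.eval_X, e] at hn
  exact ((div_lt_one (Real.exp_pos _)).mp hn).le

/-! ### Achievability -/

section Achievability

variable {X : Type*} [Fintype X]

/-- A real `r` below the divergence stands in for the divergence itself, so that the infinite case
follows by letting `r` grow. -/
lemma Problem.le_errorExponent_of_le_renyiDivSet (H : Problem X) {I : Set ℝ}
    (hadd : H.AdditivityAxiom I) (huniv : H.UniversalAxiom I) {s r R : ℝ}
    (hs : s ∈ Set.Ioo (0 : ℝ) 1) (hsI : s ∈ I) (hr : (r : EReal) ≤ renyiDivSet s H.P H.base) :
    (((1 - s) / s * (r - R) : ℝ) : EReal) ≤ H.errorExponent R := by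
  obtain ⟨⟨U, v, hU⟩, hsymm⟩ := huniv
  refine EReal_coe_le_of_forall_sub_le fun ε hε => ?_
  refine le_liminf_of_le (by isBoundedDefault) ?_
  have hs0 := hs.1
  have hs1 : 0 < 1 - s := by linarith [hs.2]
  -- `δ` is the rate reserved for the polynomial factor; it costs `(1-s)/s * δ = ε` in the exponent.
  set δ := ε * s / (1 - s) with hδ
  have hδ0 : 0 < δ := by positivity
  filter_upwards [eventually_eval_le_exp v hδ0, eventually_ge_atTop 1] with n hvn hn
  obtain ⟨hUs, hUp, hdom, hDU⟩ := hU n hn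
  have hPn := iid_nonneg H.P_mem.1 n
  have hg : chernoff s (iid H.P n) (U n) ≤ Real.exp (-((1 - s) * (n * r))) := by
    refine chernoff_le_exp_of_le_renyiDiv hPn hUs.1 hs ?_
    calc ((n * r : ℝ) : EReal) = (n : EReal) * (r : EReal) := by push_cast; rfl
      _ ≤ (n : EReal) * renyiDivSet s H.P H.base := by gcongr
      _ ≤ _ := (hadd s hsI n hn).trans (hDU s hsI)
  -- This threshold solves `exp (nδ) * exp (-sL) * exp (-(1-s)nr) = exp (-nR)`.
  set L : ℝ := n * (δ + R - (1 - s) * r) / s with hL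
  obtain ⟨T, hT01, hTinv, hTI, hTII⟩ := exists_likelihoodRatioTest hPn hUs.1 hs L
  have hTp : PermInvariant T := fun π x =>
    hTinv _ _ (permInvariant_iid H.P n π x) (hUp π x)
  refine le_neg_log_div hn ((alphaHat_le hPn (Real.exp_pos _).le hT01 fun q hq => ?_).trans
    (hTI.trans ?_))
  · rw [← sum_symmetrize_mul q T hTp]
    calc ∑ x, symmetrize q x * T x ≤ ∑ x, v.eval (n : ℝ) * (U n x * T x) := by
          refine Finset.sum_le_sum fun x _ => ?_
          rw [← mul_assoc]
          exact mul_le_mul_of_nonneg_right (hdom _ (hsymm n hn q hq) x) (hT01 x).1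
      _ = v.eval (n : ℝ) * ∑ x, U n x * T x := by rw [Finset.mul_sum]
      _ ≤ Real.exp (n * δ) * ∑ x, U n x * T x :=
          mul_le_mul_of_nonneg_right hvn
            (Finset.sum_nonneg fun x _ => mul_nonneg (hUs.1 x) (hT01 x).1)
      _ ≤ Real.exp (n * δ) * (Real.exp (-(s * L)) * Real.exp (-((1 - s) * (n * r)))) := by
          gcongr
          exact hTII.trans (by gcongr)
      _ = Real.exp (-(n * R)) := by
          rw [← Real.exp_add, ← Real.exp_add]
          congr 1
          rw [hL]; field_simp; ring
  · calc _ ≤ Real.exp ((1 - s) * L) * Real.exp (-((1 - s) * (n * r))) := by gcongr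
      _ = _ := by
          rw [← Real.exp_add]
          congr 1
          rw [hL, hδ]; field_simp; ring

lemma Problem.hoeffdingBound_le_errorExponent (H : Problem X) {a : ℝ} (ha : 0 ≤ a)
    (hadd : H.AdditivityAxiom (Set.Ioc a 1)) (huniv : H.UniversalAxiom (Set.Ioc a 1)) (R : ℝ) :
    H.hoeffdingBound a R ≤ H.errorExponent R := by
  refine iSup₂_le fun s hs => ?_
  have hs' : s ∈ Set.Ioo (0 : ℝ) 1 := ⟨ha.trans_lt hs.1, hs.2⟩
  have hβ : 0 < (1 - s) / s := div_pos (by linarith [hs.2]) hs'.1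
  have key := fun r => H.le_errorExponent_of_le_renyiDivSet (r := r) (R := R) hadd huniv hs'
    ⟨hs.1, hs.2.le⟩
  generalize renyiDivSet s H.P H.base = D at key
  induction D with
  | bot => simp [EReal.coe_mul_bot_of_pos hβ]
  | coe D => exact_mod_cast key D le_rfl
  | top =>
    refine le_top.trans (top_le_iff.mpr ((EReal.eq_top_iff_forall_lt _).mpr fun y => ?_))
    refine lt_of_lt_of_le ?_ (key (R + (y + 1) / ((1 - s) / s)) le_top)
    rw [EReal.coe_lt_coe_iff, add_sub_cancel_left, mul_div_cancel₀ _ hβ.ne']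
    linarith

end Achievability

/-! ### Analysis of the Chernoff sum in the order -/

section Order

variable {X : Type*} [Fintype X]

/-- The derivative of `log (chernoff s P Q)` in `s`. -/
noncomputable def chernoffSlope (s : ℝ) (P Q : X → ℝ) : ℝ := chernoffDeriv s P Q / chernoff s P Q

/-- This is `1 + u ≤ exp u` at `u = (t-s)(log p - log q) - m`, multiplied by `exp m`. The shift `m`
is free, so that after summation it can be taken to cancel the linear term. If `p` or `q` vanishes,
the left side is zero. -/
lemma tangent_term_le {p q s : ℝ} (hp : 0 ≤ p) (hq : 0 ≤ q) (hs : s ∈ Set.Ioo (0 : ℝ) 1)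
    (t m : ℝ) :
    p ^ s * q ^ (1 - s) * (Real.exp m * (1 + (t - s) * (Real.log p - Real.log q) - m)) ≤
      p ^ t * q ^ (1 - t) := by
  have hs1 : 1 - s ≠ 0 := by linarith [hs.2]
  have h0 : 0 ≤ p ^ t * q ^ (1 - t) := mul_nonneg (Real.rpow_nonneg hp _) (Real.rpow_nonneg hq _)
  rcases hp.eq_or_lt with rfl | hp
  · simpa [Real.zero_rpow hs.1.ne'] using h0
  rcases hq.eq_or_lt with rfl | hq
  · simpa [Real.zero_rpow hs1] using h0
  calc _ ≤ p ^ s * q ^ (1 - s) *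
        (Real.exp m * Real.exp ((t - s) * (Real.log p - Real.log q) - m)) := by
        gcongr
        linarith [Real.add_one_le_exp ((t - s) * (Real.log p - Real.log q) - m)]
    _ = _ := by
        simp only [Real.rpow_def_of_pos hp, Real.rpow_def_of_pos hq, ← Real.exp_add]
        congr 1
        ring

/-- `log (chernoff · P Q)` lies above its tangents. -/
lemma chernoff_mul_exp_le {P Q : X → ℝ} (hP : 0 ≤ P) (hQ : 0 ≤ Q) {s : ℝ}
    (hs : s ∈ Set.Ioo (0 : ℝ) 1) (hG : 0 < chernoff s P Q) (t : ℝ) :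
    chernoff s P Q * Real.exp ((t - s) * chernoffSlope s P Q) ≤ chernoff t P Q := by
  set m := (t - s) * chernoffSlope s P Q with hm
  have h := Finset.sum_le_sum fun x (_ : x ∈ Finset.univ) =>
    tangent_term_le (hP x) (hQ x) hs t m
  refine le_trans (le_of_eq ?_) h
  have e : ∀ x, P x ^ s * Q x ^ (1 - s) *
      (Real.exp m * (1 + (t - s) * (Real.log (P x) - Real.log (Q x)) - m)) =
      Real.exp m * (1 - m) * (P x ^ s * Q x ^ (1 - s)) + Real.exp m * (t - s) *
        (P x ^ s * Q x ^ (1 - s) * (Real.log (P x) - Real.log (Q x))) := fun x => by ring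
  simp only [e]
  rw [Finset.sum_add_distrib, ← Finset.mul_sum, ← Finset.mul_sum, ← chernoff, ← chernoffDeriv]
  have hd : chernoffDeriv s P Q = chernoffSlope s P Q * chernoff s P Q := by
    rw [chernoffSlope, div_mul_cancel₀ _ hG.ne']
  rw [hd, show Real.exp m * (t - s) * (chernoffSlope s P Q * chernoff s P Q) =
    Real.exp m * chernoff s P Q * m by rw [hm]; ring]
  ring

lemma log_chernoff_add_le {P Q : X → ℝ} (hP : 0 ≤ P) (hQ : 0 ≤ Q) {s : ℝ}
    (hs : s ∈ Set.Ioo (0 : ℝ) 1) (hG : 0 < chernoff s P Q) (t : ℝ) :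
    Real.log (chernoff s P Q) + (t - s) * chernoffSlope s P Q ≤ Real.log (chernoff t P Q) := by
  have h := Real.log_le_log (by positivity) (chernoff_mul_exp_le hP hQ hs hG t)
  rwa [Real.log_mul hG.ne' (Real.exp_pos _).ne', Real.log_exp] at h

/-- The tangent at `s` is compared with the value at order `0`, where the convention `0 ^ 0 = 1`
makes the Chernoff sum the full mass of `Q`. -/
lemma slope_sub_log_chernoff_nonneg {P Q : X → ℝ} (hP : 0 ≤ P) (hQ : Q ∈ stdSimplex ℝ X) {s : ℝ}
    (hs : s ∈ Set.Ioo (0 : ℝ) 1) (hG : 0 < chernoff s P Q) :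
    0 ≤ s * chernoffSlope s P Q - Real.log (chernoff s P Q) := by
  have h := log_chernoff_add_le hP hQ.1 hs hG 0
  have h0 : chernoff 0 P Q = 1 := by simp [chernoff, hQ.2]
  rw [h0, Real.log_one] at h
  linarith

end Order

/-! ### Joint continuity in the order and the parameter -/

section Continuity

variable {X : Type*} [Fintype X] {E : Type*} [TopologicalSpace E]

/-- The singularity of `log` at `0` is absorbed: `q^{1-s} log q = -(1-s)⁻¹ negMulLog (q^{1-s})`, and
`negMulLog` is continuous. -/
lemma continuousOn_rpow_mul_log :
    ContinuousOn (fun p : ℝ × ℝ => p.2 ^ (1 - p.1) * Real.log p.2)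
      (Set.Ioo 0 1 ×ˢ Set.Ici 0) := by
  have h : ContinuousOn (fun p : ℝ × ℝ => -(1 - p.1)⁻¹ * Real.negMulLog (p.2 ^ (1 - p.1)))
      (Set.Ioo 0 1 ×ˢ Set.Ici 0) := by
    refine ContinuousOn.mul (ContinuousOn.neg (ContinuousOn.inv₀ (by fun_prop) ?_))
      (Real.continuous_negMulLog.comp_continuousOn
        (ContinuousOn.rpow (by fun_prop) (by fun_prop) ?_))
    · rintro ⟨s, q⟩ ⟨hs, -⟩
      exact (by linarith [hs.2] : 0 < 1 - s).ne'
    · rintro ⟨s, q⟩ ⟨hs, -⟩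
      exact Or.inr (by linarith [hs.2] : 0 < 1 - s)
  refine h.congr ?_
  rintro ⟨s, q⟩ ⟨hs, hq⟩
  have h1 : 0 < 1 - s := by linarith [hs.2]
  rcases (Set.mem_Ici.mp hq).eq_or_lt with h0 | h0
  · simp only at h0
    subst h0
    simp [Real.zero_rpow h1.ne']
  · simp only [Real.negMulLog, Real.log_rpow h0]
    field_simp

variable {P : X → ℝ} {Q : E → X → ℝ} {Θ : Set E}

lemma continuousOn_chernoff (hQc : ContinuousOn Q Θ) :
    ContinuousOn (fun p : ℝ × E => chernoff p.1 P (Q p.2)) (Set.Ioo 0 1 ×ˢ Θ) := by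
  refine continuousOn_finsetSum _ fun x _ => ContinuousOn.mul
    (ContinuousOn.rpow continuousOn_const continuousOn_fst ?_)
    (ContinuousOn.rpow ?_ (by fun_prop) ?_)
  · rintro ⟨s, θ⟩ ⟨hs, -⟩
    exact Or.inr hs.1
  · exact ((continuous_apply x).comp_continuousOn hQc).comp continuousOn_snd fun p hp => hp.2
  · rintro ⟨s, θ⟩ ⟨hs, -⟩
    exact Or.inr (by linarith [hs.2] : 0 < 1 - s)

lemma continuousOn_chernoffDeriv (hQc : ContinuousOn Q Θ) (hQ : ∀ θ ∈ Θ, 0 ≤ Q θ) :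
    ContinuousOn (fun p : ℝ × E => chernoffDeriv p.1 P (Q p.2)) (Set.Ioo 0 1 ×ˢ Θ) := by
  have hQx : ∀ x, ContinuousOn (fun p : ℝ × E => Q p.2 x) (Set.Ioo (0 : ℝ) 1 ×ˢ Θ) := fun x =>
    ((continuous_apply x).comp_continuousOn hQc).comp continuousOn_snd fun p hp => hp.2
  have h : ContinuousOn (fun p : ℝ × E => ∑ x, P x ^ p.1 *
      (Q p.2 x ^ (1 - p.1) * Real.log (P x) - Q p.2 x ^ (1 - p.1) * Real.log (Q p.2 x)))
      (Set.Ioo 0 1 ×ˢ Θ) := by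
    refine continuousOn_finsetSum _ fun x _ => ContinuousOn.mul
      (ContinuousOn.rpow continuousOn_const continuousOn_fst ?_) (ContinuousOn.sub
        (ContinuousOn.mul (ContinuousOn.rpow (hQx x) (by fun_prop) ?_) continuousOn_const) ?_)
    · rintro ⟨s, θ⟩ ⟨hs, -⟩
      exact Or.inr hs.1
    · rintro ⟨s, θ⟩ ⟨hs, -⟩
      exact Or.inr (by linarith [hs.2] : 0 < 1 - s)
    · exact continuousOn_rpow_mul_log.comp (continuousOn_fst.prodMk (hQx x))
        fun p hp => ⟨hp.1, hQ p.2 hp.2 x⟩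
  refine h.congr fun p _ => ?_
  simp only [chernoffDeriv]
  exact Finset.sum_congr rfl fun x _ => by ring

/-- Unique maximizers of the Chernoff sum depend continuously on the order. -/
lemma continuousOn_argmax {I : Set ℝ} (hI : I ⊆ Set.Ioo 0 1) (hΘ : IsCompact Θ)
    (hQc : ContinuousOn Q Θ) {τ : ℝ → E} (hτ : ∀ s ∈ I, τ s ∈ Θ)
    (hmax : ∀ s ∈ I, ∀ θ ∈ Θ, θ ≠ τ s → chernoff s P (Q θ) < chernoff s P (Q (τ s))) :
    ContinuousOn τ I := by
  intro s hs
  -- By compactness it suffices that every cluster point is `τ s`. Along an ultrafilter, the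
  -- inequality between the values at `τ s` and `τ t` passes to the limit, so a cluster point is
  -- again a maximizer at order `s`.
  refine hΘ.tendsto_nhds_of_unique_mapClusterPt (eventually_mem_nhdsWithin.mono hτ)
    fun θ hθ hcl => ?_
  obtain ⟨u, hu, huθ⟩ := mapClusterPt_iff_ultrafilter.mp hcl
  have hus : Tendsto id (u : Filter ℝ) (𝓝 s) := hu.trans nhdsWithin_le_nhds
  have huI : ∀ᶠ t in (u : Filter ℝ), t ∈ I := hu eventually_mem_nhdsWithin
  have lim : ∀ (f : ℝ → E) (θ' : E), θ' ∈ Θ → (∀ t ∈ I, f t ∈ Θ) → Tendsto f u (𝓝 θ') →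
      Tendsto (fun t => chernoff t P (Q (f t))) u (𝓝 (chernoff s P (Q θ'))) := by
    intro f θ' hθ' hf hft
    refine (continuousOn_chernoff (P := P) hQc (s, θ') ⟨hI hs, hθ'⟩).tendsto.comp
      (f := fun t => (t, f t)) (tendsto_nhdsWithin_iff.mpr ⟨hus.prodMk_nhds hft, ?_⟩)
    filter_upwards [huI] with t ht using ⟨hI ht, hf t ht⟩
  by_contra hne
  refine (hmax s hs θ hθ hne).not_ge (le_of_tendsto_of_tendsto
    (lim (fun _ => τ s) (τ s) (hτ s hs) (fun _ _ => hτ s hs) tendsto_const_nhds)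
    (lim τ θ hθ hτ huθ) ?_)
  filter_upwards [huI] with t ht
  by_cases h : τ s = τ t
  · rw [h]
  · exact (hmax t ht _ (hτ s hs) h).le

lemma continuousOn_chernoffSlope_argmax {I : Set ℝ} (hI : I ⊆ Set.Ioo 0 1)
    (hQc : ContinuousOn Q Θ) (hQ : ∀ θ ∈ Θ, 0 ≤ Q θ) {τ : ℝ → E} (hτ : ∀ s ∈ I, τ s ∈ Θ)
    (hτc : ContinuousOn τ I) (hpos : ∀ s ∈ I, 0 < chernoff s P (Q (τ s))) :
    ContinuousOn (fun s => chernoffSlope s P (Q (τ s))) I := by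
  have hmaps : Set.MapsTo (fun s => (s, τ s)) I (Set.Ioo (0 : ℝ) 1 ×ˢ Θ) :=
    fun s hs => ⟨hI hs, hτ s hs⟩
  have hc : ContinuousOn (fun s => (s, τ s)) I := continuousOn_id.prodMk hτc
  have h1 := ContinuousOn.comp (continuousOn_chernoffDeriv (P := P) hQc hQ) hc hmaps
  have h2 := ContinuousOn.comp (continuousOn_chernoff (P := P) hQc) hc hmaps
  exact h1.div h2 fun s hs => (hpos s hs).ne'

end Continuity

/-- A function with a continuous selection of subgradients is differentiable. -/
lemma hasDerivAt_of_subgradient {φ c : ℝ → ℝ} {I : Set ℝ} (hc : ContinuousOn c I)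
    (h : ∀ s ∈ I, ∀ t ∈ I, φ s + (t - s) * c s ≤ φ t) {s : ℝ} (hs : I ∈ 𝓝 s) :
    HasDerivAt φ (c s) s := by
  have hsI := mem_of_mem_nhds hs
  rw [hasDerivAt_iff_isLittleO, Asymptotics.isLittleO_iff]
  intro ε hε
  filter_upwards [hs, (hc.continuousAt hs).eventually (Metric.ball_mem_nhds _ hε)] with t ht hct
  -- The subgradient inequalities at `s` and at `t` sandwich the error: `0 ≤ φ t - φ s - (t-s) c s ≤
  -- (t-s)(c t - c s)`.
  have h1 := h s hsI t ht
  have h2 := h t ht s hsI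
  have h3 : |c t - c s| ≤ ε := (Real.dist_eq _ _ ▸ Metric.mem_ball.mp hct).le
  rw [smul_eq_mul, Real.norm_eq_abs, Real.norm_eq_abs, abs_of_nonneg (by linarith)]
  calc φ t - φ s - (t - s) * c s ≤ (t - s) * (c t - c s) := by linarith
    _ ≤ |t - s| * |c t - c s| := (le_abs_self _).trans (abs_mul _ _).le
    _ ≤ |t - s| * ε := by gcongr
    _ = _ := mul_comm _ _

/-- `s * c s - φ s` is minus the intercept at `0` of the supporting line at `s`; for a convex
function on the positive axis this intercept decreases with `s`. -/
lemma monotoneOn_of_subgradient {φ c : ℝ → ℝ} {I : Set ℝ} (hI : I ⊆ Set.Ioi 0)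
    (h : ∀ s ∈ I, ∀ t ∈ I, φ s + (t - s) * c s ≤ φ t) :
    MonotoneOn (fun s => s * c s - φ s) I := by
  intro s hs t ht hst
  have h1 := h s hs t ht
  have h2 := h t ht s hs
  rcases hst.eq_or_lt with rfl | hlt
  · rfl
  have hcc : c s ≤ c t := by nlinarith
  have := mul_le_mul_of_nonneg_left hcc (Set.mem_Ioi.mp (hI hs)).le
  dsimp only
  linarith

/-- Orders at which the rate is just below `R`, or which are close to `1`. -/
lemma exists_order_near {a R : ℝ} (ha : 0 ≤ a) (hR : 0 ≤ R) {ψ : ℝ → ℝ}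
    (hc : ContinuousOn ψ (Set.Ioo a 1)) (hm : MonotoneOn ψ (Set.Ioo a 1))
    (h0 : ∀ s ∈ Set.Ioo a 1, 0 ≤ ψ s) {s₀ : ℝ} (hs₀ : s₀ ∈ Set.Ioo a 1) (hψ : ψ s₀ < R)
    {ε : ℝ} (hε : 0 < ε) :
    ∃ s ∈ Set.Ioo a 1, ψ s < R ∧ (1 - s) * (R - ψ s) / s ≤ ε := by
  have hp := ha.trans_lt hs₀.1
  have bound : ∀ s ∈ Set.Ioo a 1, s₀ ≤ s → (1 - s) * (R - ψ s) ≤ ε * s₀ →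
      (1 - s) * (R - ψ s) / s ≤ ε := fun s hs h1 h2 => by
    rw [div_le_iff₀ (ha.trans_lt hs.1)]
    exact h2.trans (by gcongr)
  by_cases hex : ∃ t ∈ Set.Ioo a 1, R ≤ ψ t
  · obtain ⟨t, ht, hRt⟩ := hex
    have hst : s₀ ≤ t := by
      by_contra! hlt
      linarith [hm ht hs₀ hlt.le]
    have hsub : Set.Icc s₀ t ⊆ Set.Ioo a 1 := fun x hx =>
      ⟨hs₀.1.trans_le hx.1, hx.2.trans_lt ht.2⟩
    -- The level is below `R` by at most `ε * s₀`, and `s ≥ s₀` compensates the division by `s`; the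
    -- maximum keeps the level in the range of `ψ` on `[s₀, t]`.
    obtain ⟨s, hs, hsy⟩ := intermediate_value_Icc hst (hc.mono hsub)
      (show max (ψ s₀) (R - ε * s₀) ∈ Set.Icc (ψ s₀) (ψ t) from
        ⟨le_max_left _ _, max_le (by linarith) (by nlinarith)⟩)
    have hlt : ψ s < R := hsy ▸ max_lt hψ (by nlinarith)
    have hge : R - ε * s₀ ≤ ψ s := hsy ▸ le_max_right _ _
    have hs' := hsub hs
    refine ⟨s, hs', hlt, bound s hs' hs.1 ?_⟩
    have : (1 - s) * (R - ψ s) ≤ 1 * (R - ψ s) :=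
      mul_le_mul_of_nonneg_right (by linarith [hs'.1]) (by linarith)
    linarith
  · push Not at hex
    -- Here `0 ≤ ψ < R` throughout, so `R - ψ s ≤ R + 1` and it is enough that `1 - s ≤ ε * s₀ / (R
    -- + 1)`.
    have hq : 0 < ε * s₀ / (R + 1) := by positivity
    have hs' : max s₀ (1 - ε * s₀ / (R + 1)) ∈ Set.Ioo a 1 :=
      ⟨hs₀.1.trans_le (le_max_left _ _), max_lt hs₀.2 (by linarith)⟩
    refine ⟨_, hs', hex _ hs', bound _ hs' (le_max_left _ _) ?_⟩
    calc _ ≤ ε * s₀ / (R + 1) * (R + 1) := by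
          refine mul_le_mul ?_ ?_ ?_ hq.le
          · linarith [le_max_right s₀ (1 - ε * s₀ / (R + 1))]
          · linarith [h0 _ hs']
          · linarith [hex _ hs']
      _ = _ := by field_simp

/-! ### Product distributions -/

section

variable {X : Type*}

lemma iid_cons (V : X → ℝ) {n : ℕ} (a : X) (x : Fin n → X) :
    iid V (n + 1) (Fin.cons a x : Fin (n + 1) → X) = V a * iid V n x := by
  simp [iid, Fin.prod_univ_succ]

lemma iid_le_of_le_mul_exp {V W h : X → ℝ} {b : ℝ} (hV : 0 ≤ V)
    (hVW : ∀ x, V x ≤ W x * Real.exp (h x + b)) {n : ℕ} (x : Fin n → X) :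
    iid V n x ≤ iid W n x * Real.exp (∑ i, h (x i) + n * b) := by
  calc iid V n x ≤ ∏ i, (W (x i) * Real.exp (h (x i) + b)) :=
        Finset.prod_le_prod (fun i _ => hV _) fun i _ => hVW _
    _ = _ := by
        rw [Finset.prod_mul_distrib, ← Real.exp_sum, Finset.sum_add_distrib]
        simp [iid]

end

section IID

variable {X : Type*} [Fintype X]

lemma sum_fin_succ_pi {n : ℕ} (f : (Fin (n + 1) → X) → ℝ) :
    ∑ x, f x = ∑ a, ∑ x : Fin n → X, f (Fin.cons a x) := by
  rw [← Fintype.sum_prod_type']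
  exact (Fintype.sum_equiv (Fin.consEquiv fun _ => X) _ _ fun _ => rfl).symm

lemma sum_iid {V : X → ℝ} (hV : ∑ x, V x = 1) (n : ℕ) : ∑ x, iid V n x = 1 := by
  induction n with
  | zero => simp [iid]
  | succ n ih => simp only [sum_fin_succ_pi, iid_cons, ← Finset.mul_sum, ih, mul_one, hV]

lemma sum_iid_mul_sum {V h : X → ℝ} (hV : ∑ x, V x = 1) (hh : ∑ x, V x * h x = 0) (n : ℕ) :
    ∑ x, iid V n x * ∑ i, h (x i) = 0 := by
  induction n with
  | zero => simp
  | succ n ih =>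
    have e : ∀ a (x : Fin n → X), V a * iid V n x * (h a + ∑ i, h (x i)) =
        V a * h a * iid V n x + V a * (iid V n x * ∑ i, h (x i)) := fun a x => by ring
    simp only [sum_fin_succ_pi, iid_cons, Fin.sum_univ_succ, Fin.cons_zero, Fin.cons_succ, e,
      Finset.sum_add_distrib, ← Finset.mul_sum, ih, sum_iid hV, mul_one, hh, mul_zero,
      add_zero]

/-- The variance of a sum of independent centred terms is additive: the cross terms vanish. This
feeds Chebyshev's inequality. -/
lemma sum_iid_mul_sum_sq {V h : X → ℝ} (hV : ∑ x, V x = 1) (hh : ∑ x, V x * h x = 0) (n : ℕ) :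
    ∑ x, iid V n x * (∑ i, h (x i)) ^ 2 = n * ∑ x, V x * h x ^ 2 := by
  induction n with
  | zero => simp
  | succ n ih =>
    have e : ∀ a (x : Fin n → X), V a * iid V n x * (h a + ∑ i, h (x i)) ^ 2 =
        V a * h a ^ 2 * iid V n x + 2 * (V a * h a) * (iid V n x * ∑ i, h (x i)) +
          V a * (iid V n x * (∑ i, h (x i)) ^ 2) := fun a x => by ring
    simp only [sum_fin_succ_pi, iid_cons, Fin.sum_univ_succ, Fin.cons_zero, Fin.cons_succ, e,
      Finset.sum_add_distrib, ← Finset.mul_sum, ih, sum_iid hV, sum_iid_mul_sum hV hh, mul_one,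
      mul_zero, add_zero, ← Finset.sum_mul, hV]
    push_cast
    ring

/-- Change of measure: if `V` has bounded log-likelihood ratios `σ h + ψ` and `-(1-σ) h + f` with
respect to `Q` and `P`, with `h` centred under `V`, then both errors cannot be small. -/
lemma one_le_errors {P Q V h : X → ℝ} {σ ψ f δ : ℝ} (hP : 0 ≤ P) (hQ : 0 ≤ Q)
    (hV : V ∈ stdSimplex ℝ X) (hh : ∑ x, V x * h x = 0) (hσ : σ ∈ Set.Icc (0 : ℝ) 1) (hδ : 0 < δ)
    (hVQ : ∀ x, V x ≤ Q x * Real.exp (σ * h x + ψ))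
    (hVP : ∀ x, V x ≤ P x * Real.exp (-(1 - σ) * h x + f)) {n : ℕ} (hn : 1 ≤ n)
    {T : (Fin n → X) → ℝ} (hT : ∀ x, T x ∈ Set.Icc (0 : ℝ) 1) :
    1 ≤ Real.exp (n * (ψ + δ)) * ∑ x, iid Q n x * T x +
      Real.exp (n * (f + δ)) * typeI T (iid P n) + (∑ x, V x * h x ^ 2) / (n * δ ^ 2) := by
  have hn0 : (0 : ℝ) < n := by exact_mod_cast hn
  -- Where `|S| ≤ nδ`, split `V^n = V^n T + V^n (1 - T)` and bound the parts through `Q` and `P`,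
  -- the deviation `S` costing at most `nδ` because `σ` and `1 - σ` lie in `[0,1]`. Elsewhere the
  -- Chebyshev factor `S² / (nδ)²` exceeds `1`.
  have key : ∀ x : Fin n → X, iid V n x ≤ Real.exp (n * (ψ + δ)) * (iid Q n x * T x) +
      Real.exp (n * (f + δ)) * (iid P n x * (1 - T x)) +
        iid V n x * (∑ i, h (x i)) ^ 2 * ((n * δ) ^ 2)⁻¹ := by
    intro x
    have hV0 := iid_nonneg hV.1 n x
    have hQ0 := iid_nonneg hQ n x
    have hP0 := iid_nonneg hP n x
    simp only [Pi.zero_apply] at hV0 hQ0 hP0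
    have hT0 := (hT x).1
    have hT1 : 0 ≤ 1 - T x := by linarith [(hT x).2]
    set S := ∑ i, h (x i) with hS
    rcases le_or_gt |S| (n * δ) with hle | hgt
    · obtain ⟨hl, hu⟩ := abs_le.mp hle
      have h1 : iid V n x ≤ iid Q n x * Real.exp (n * (ψ + δ)) := by
        refine (iid_le_of_le_mul_exp hV.1 hVQ x).trans ?_
        rw [← Finset.mul_sum, ← hS]
        gcongr
        nlinarith [hσ.1, hσ.2]
      have h2 : iid V n x ≤ iid P n x * Real.exp (n * (f + δ)) := by
        refine (iid_le_of_le_mul_exp hV.1 hVP x).trans ?_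
        rw [← Finset.mul_sum, ← hS]
        gcongr
        nlinarith [hσ.1, hσ.2]
      have h3 : 0 ≤ iid V n x * S ^ 2 * ((n * δ) ^ 2)⁻¹ := by positivity
      nlinarith [mul_le_mul_of_nonneg_right h1 hT0, mul_le_mul_of_nonneg_right h2 hT1]
    · have h1 : 1 ≤ S ^ 2 * ((n * δ) ^ 2)⁻¹ := by
        rw [← div_eq_mul_inv, one_le_div (by positivity), ← sq_abs S]
        gcongr
      have h2 : 0 ≤ Real.exp (n * (ψ + δ)) * (iid Q n x * T x) := by positivity
      have h3 : 0 ≤ Real.exp (n * (f + δ)) * (iid P n x * (1 - T x)) := by positivity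
      nlinarith [mul_le_mul_of_nonneg_left h1 hV0]
  have hsum := Finset.sum_le_sum fun x (_ : x ∈ Finset.univ) => key x
  rw [sum_iid hV.2, Finset.sum_add_distrib, Finset.sum_add_distrib, ← Finset.mul_sum,
    ← Finset.mul_sum, ← Finset.sum_mul, sum_iid_mul_sum_sq hV.2 hh] at hsum
  refine hsum.trans (le_of_eq ?_)
  rw [typeI]
  congr 1
  field_simp

/-- Both are equalities for `p, q > 0`. If `p` or `q` vanishes, so does the tilted mass, and the
value of `log 0` is harmless. -/
lemma chernoff_term_div_le {p q s : ℝ} (hp : 0 ≤ p) (hq : 0 ≤ q) (hs : s ∈ Set.Ioo (0 : ℝ) 1)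
    {G : ℝ} (hG : 0 < G) (c : ℝ) :
    p ^ s * q ^ (1 - s) / G ≤
        q * Real.exp (s * (Real.log p - Real.log q - c) + (s * c - Real.log G)) ∧
      p ^ s * q ^ (1 - s) / G ≤
        p * Real.exp (-(1 - s) * (Real.log p - Real.log q - c) +
          (-Real.log G - (1 - s) * c)) := by
  have hs1 : 1 - s ≠ 0 := by linarith [hs.2]
  rcases hp.eq_or_lt with rfl | hp
  · rw [Real.zero_rpow hs.1.ne', zero_mul, zero_div]
    exact ⟨by positivity, by positivity⟩
  rcases hq.eq_or_lt with rfl | hq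
  · rw [Real.zero_rpow hs1, mul_zero, zero_div]
    exact ⟨by positivity, by positivity⟩
  have e : p ^ s * q ^ (1 - s) / G =
      Real.exp (Real.log p * s + Real.log q * (1 - s) - Real.log G) := by
    rw [Real.exp_sub, Real.exp_add, Real.exp_log hG, Real.rpow_def_of_pos hp,
      Real.rpow_def_of_pos hq]
  constructor
  · rw [e]
    nth_rewrite 2 [← Real.exp_log hq]
    rw [← Real.exp_add]
    exact le_of_eq (by ring_nf)
  · rw [e]
    nth_rewrite 2 [← Real.exp_log hp]
    rw [← Real.exp_add]
    exact le_of_eq (by ring_nf)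

/-- The converse bound for a simple alternative, through the tilted distribution of order `s`. -/
lemma eventually_exp_le_typeI {P Q : X → ℝ} (hP : 0 ≤ P) (hQ : 0 ≤ Q) {s R ε : ℝ}
    (hs : s ∈ Set.Ioo (0 : ℝ) 1) (hG : 0 < chernoff s P Q)
    (hR : s * chernoffSlope s P Q - Real.log (chernoff s P Q) < R) (hε : 0 < ε) :
    ∀ᶠ n : ℕ in atTop, ∀ T : (Fin n → X) → ℝ, (∀ x, T x ∈ Set.Icc (0 : ℝ) 1) →
      ∑ x, iid Q n x * T x ≤ Real.exp (-(n * R)) →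
      Real.exp (-(n * (-Real.log (chernoff s P Q) - (1 - s) * chernoffSlope s P Q + ε))) ≤
        typeI T (iid P n) := by
  set G := chernoff s P Q with hGdef
  set c := chernoffSlope s P Q with hc
  set ψ := s * c - Real.log G with hψ
  set f := -Real.log G - (1 - s) * c with hf
  set V : X → ℝ := fun x => P x ^ s * Q x ^ (1 - s) / G with hVdef
  set h : X → ℝ := fun x => Real.log (P x) - Real.log (Q x) - c with hh
  have hV : V ∈ stdSimplex ℝ X := by
    refine ⟨fun x => div_nonneg (mul_nonneg (Real.rpow_nonneg (hP x) _)
      (Real.rpow_nonneg (hQ x) _)) hG.le, ?_⟩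
    rw [hVdef, ← Finset.sum_div]
    exact div_self hG.ne'
  have hVh : ∑ x, V x * h x = 0 := by
    have e : ∀ x, V x * h x =
        P x ^ s * Q x ^ (1 - s) * (Real.log (P x) - Real.log (Q x)) / G - V x * c := fun x => by
      simp only [hVdef, hh]; ring
    simp only [e]
    rw [Finset.sum_sub_distrib, ← Finset.sum_div, ← Finset.sum_mul, hV.2, ← chernoffDeriv, hc,
      chernoffSlope, one_mul, sub_self]
  -- Half of `R - ψ` makes the type-II term at most `exp (-nδ)`; half of `ε` leaves a factor `exp
  -- (-nδ)` to absorb the constant `1/2` below.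
  set δ := min ((R - ψ) / 2) (ε / 2) with hδdef
  have hδ : 0 < δ := lt_min (by linarith) (by linarith)
  have hδ1 : δ ≤ (R - ψ) / 2 := min_le_left _ _
  have hδ2 : δ ≤ ε / 2 := min_le_right _ _
  have t1 : Tendsto (fun n : ℕ => Real.exp (-(n * δ))) atTop (𝓝 0) :=
    Real.tendsto_exp_neg_atTop_nhds_zero.comp (tendsto_natCast_atTop_atTop.atTop_mul_const hδ)
  have t2 : Tendsto (fun n : ℕ => (∑ x, V x * h x ^ 2) / (n * δ ^ 2)) atTop (𝓝 0) :=
    tendsto_const_nhds.div_atTop (tendsto_natCast_atTop_atTop.atTop_mul_const (by positivity))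
  filter_upwards [eventually_ge_atTop 1, t1.eventually (gt_mem_nhds (show (0 : ℝ) < 1 / 4 by norm_num)),
    t2.eventually (gt_mem_nhds (show (0 : ℝ) < 1 / 4 by norm_num))] with n hn h1 h2 T hT hTQ
  have hb := one_le_errors hP hQ hV hVh ⟨hs.1.le, hs.2.le⟩ hδ
    (fun x => (chernoff_term_div_le (hP x) (hQ x) hs hG c).1)
    (fun x => (chernoff_term_div_le (hP x) (hQ x) hs hG c).2) hn hT
  have h3 : Real.exp (n * (ψ + δ)) * ∑ x, iid Q n x * T x ≤ 1 / 4 := by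
    calc _ ≤ Real.exp (n * (ψ + δ)) * Real.exp (-(n * R)) := by gcongr
      _ = Real.exp (n * (ψ + δ - R)) := by rw [← Real.exp_add]; ring_nf
      _ ≤ Real.exp (n * -δ) := by gcongr; linarith
      _ ≤ 1 / 4 := by rw [mul_neg]; exact h1.le
  have h4 : 1 / 2 ≤ Real.exp (n * (f + δ)) * typeI T (iid P n) := by linarith
  have h5 : Real.exp (-(n * (f + δ))) * (1 / 2) ≤ typeI T (iid P n) := by
    calc _ ≤ Real.exp (-(n * (f + δ))) * (Real.exp (n * (f + δ)) * typeI T (iid P n)) := by gcongr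
      _ = _ := by rw [← mul_assoc, ← Real.exp_add]; simp
  refine le_trans ?_ h5
  calc Real.exp (-(n * (f + ε))) ≤ Real.exp (-(n * (f + δ)) + -(n * δ)) := by
        gcongr
        have : (0 : ℝ) ≤ n := n.cast_nonneg
        nlinarith
    _ = Real.exp (-(n * (f + δ))) * Real.exp (-(n * δ)) := Real.exp_add _ _
    _ ≤ _ := by gcongr; linarith

end IID

/-! ### Converse -/

section Converse

variable {X : Type*} [Fintype X]

/-- Because `q^{×n}` belongs to `H.Q n`, the composite problem is at least as hard as the simple one
with alternative `q`. -/
lemma Problem.errorExponent_le (H : Problem X) (hprod : H.ProductAxiom) {q : X → ℝ}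
    (hq : q ∈ H.base) (hq0 : 0 ≤ q) {s R : ℝ} (hs : s ∈ Set.Ioo (0 : ℝ) 1)
    (hG : 0 < chernoff s H.P q)
    (hR : s * chernoffSlope s H.P q - Real.log (chernoff s H.P q) < R) :
    H.errorExponent R ≤
      ((-Real.log (chernoff s H.P q) - (1 - s) * chernoffSlope s H.P q : ℝ) : EReal) := by
  refine EReal_le_coe_of_forall_le_add fun ε hε => ?_
  refine liminf_le_of_frequently_le' (Eventually.frequently ?_)
  filter_upwards [eventually_exp_le_typeI H.P_mem.1 hq0 hs hG hR hε, eventually_ge_atTop 1]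
    with n hev hn
  exact neg_log_div_le hn (le_alphaHat (Real.exp_pos _).le (H.Q_subset n) (hprod n hn q hq) hev)

end Converse

/-! ### Differentiability of `φ`, critical rate and equality -/

section Main

variable {X : Type*} [Fintype X]

/-- The criterion does not involve `s`: overlap of the supports settles positivity for all orders at
once. -/
lemma chernoff_pos_iff {P Q : X → ℝ} (hP : 0 ≤ P) (hQ : 0 ≤ Q) {s : ℝ}
    (hs : s ∈ Set.Ioo (0 : ℝ) 1) : 0 < chernoff s P Q ↔ ∃ x, 0 < P x ∧ 0 < Q x := by
  have hs1 : 1 - s ≠ 0 := by linarith [hs.2]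
  rw [chernoff, Finset.sum_pos_iff_of_nonneg fun x _ =>
    mul_nonneg (Real.rpow_nonneg (hP x) _) (Real.rpow_nonneg (hQ x) _)]
  refine ⟨fun ⟨x, _, hx⟩ => ⟨x, ?_⟩, fun ⟨x, hp, hq⟩ => ⟨x, Finset.mem_univ x, by positivity⟩⟩
  by_contra hcon
  rcases (hP x).eq_or_lt with hp | hp
  · simp [← hp, Real.zero_rpow hs.1.ne'] at hx
  rcases (hQ x).eq_or_lt with hq | hq
  · simp [← hq, Real.zero_rpow hs1] at hx
  exact hcon ⟨hp, hq⟩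

lemma Problem.base_subset (H : Problem X) : H.base ⊆ stdSimplex ℝ X := by
  intro q hq
  have h := H.Q_subset 1 hq
  refine ⟨fun x => h.1 fun _ => x, ?_⟩
  rw [← h.2]
  exact (Fintype.sum_equiv (Equiv.funUnique (Fin 1) X) _ _ fun _ => rfl).symm

lemma renyiDivSet_eq_of_chernoff_le {P q : X → ℝ} {𝒬 : Set (X → ℝ)} (hP : 0 ≤ P)
    (h𝒬 : 𝒬 ⊆ stdSimplex ℝ X) (hq : q ∈ 𝒬) {s : ℝ} (hs : s ∈ Set.Ioo (0 : ℝ) 1)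
    (hmax : ∀ q' ∈ 𝒬, chernoff s P q' ≤ chernoff s P q) :
    renyiDivSet s P 𝒬 = renyiDiv s P q :=
  le_antisymm (iInf₂_le q hq) (le_iInf₂ fun q' hq' =>
    renyiDiv_le_renyiDiv hP (h𝒬 hq').1 (h𝒬 hq).1 hs (hmax q' hq'))

/-- If `ψ` is monotone and nonnegative on `(a, 1)`, it has a limit at `a`. -/
lemma exists_tendsto_nhdsGT {a : ℝ} (ha : a < 1) {ψ : ℝ → ℝ} (hm : MonotoneOn ψ (Set.Ioo a 1))
    (h0 : ∀ s ∈ Set.Ioo a 1, 0 ≤ ψ s) : ∃ l, Tendsto ψ (𝓝[>] a) (𝓝 l) := by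
  obtain ⟨b, hab, hb⟩ := exists_between ha
  have hp : ∀ s, a < s → min s b ∈ Set.Ioo a 1 := fun s hs =>
    ⟨lt_min hs hab, (min_le_right _ _).trans_lt hb⟩
  -- Freezing `ψ` beyond `b` gives a monotone function on all of `(a, ∞)` that agrees with `ψ` near
  -- `a`.
  have hmono : MonotoneOn (fun s => ψ (min s b)) (Set.Ioi a) := fun s hs t ht hst =>
    hm (hp s hs) (hp t ht) (min_le_min_right b hst)
  refine ⟨_, (hmono.tendsto_nhdsGT ⟨0, ?_⟩).congr' ?_⟩
  · rintro _ ⟨s, hs, rfl⟩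
    exact h0 _ (hp s hs)
  · filter_upwards [Ioo_mem_nhdsGT hab] with s hs
    rw [min_eq_left hs.2.le]

/-- The degenerate case: `toReal ⊤ = 0` makes `φ` vanish, and the Hoeffding bound is already `⊤`. -/
lemma Problem.errorExponent_eq_of_divergence_top (H : Problem X) {a : ℝ} (ha0 : 0 ≤ a) (ha1 : a < 1)
    (hle : ∀ R, H.hoeffdingBound a R ≤ H.errorExponent R)
    (htop : ∀ s ∈ Set.Ioo a 1, renyiDivSet s H.P H.base = ⊤) :
    DifferentiableOn ℝ (phi H.P H.base) (Set.Ioo a 1) ∧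
    Tendsto (psi H.P H.base) (𝓝[>] a) (𝓝 (criticalRate H.P H.base a)) ∧
    ∀ R : ℝ, H.errorExponent R = H.hoeffdingBound a R := by
  have hphi : ∀ s ∈ Set.Ioo a 1, phi H.P H.base s = 0 := fun s hs => by simp [phi, htop s hs]
  have hder : ∀ s ∈ Set.Ioo a 1, HasDerivAt (phi H.P H.base) 0 s := fun s hs =>
    (hasDerivAt_const s (0 : ℝ)).congr_of_eventuallyEq
      ((isOpen_Ioo.eventually_mem hs).mono hphi)
  refine ⟨fun s hs => (hder s hs).differentiableAt.differentiableWithinAt,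
    tendsto_nhds_limUnder ⟨0, tendsto_const_nhds.congr' ?_⟩, fun R => ?_⟩
  · filter_upwards [Ioo_mem_nhdsGT ha1] with s hs
    simp [psi, (hder s hs).deriv, hphi s hs]
  · have : H.hoeffdingBound a R = ⊤ := by
      obtain ⟨s, hs⟩ := exists_between ha1
      refine top_le_iff.mp (le_trans (le_of_eq ?_) (le_iSup₂ s hs))
      rw [htop s hs, EReal.top_sub_coe, EReal.coe_mul_top_of_pos]
      exact div_pos (by linarith [hs.2]) (ha0.trans_lt hs.1)
    exact le_antisymm (this ▸ le_top) (hle R)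

lemma Problem.errorExponent_eq_of_argmax (H : Problem X) {a : ℝ} (ha0 : 0 ≤ a) (ha1 : a < 1)
    (hle : ∀ R, H.hoeffdingBound a R ≤ H.errorExponent R) (hprod : H.ProductAxiom)
    {q : ℝ → X → ℝ} (hq : ∀ s ∈ Set.Ioo a 1, q s ∈ H.base)
    (hmax : ∀ s ∈ Set.Ioo a 1, ∀ q' ∈ H.base, chernoff s H.P q' ≤ chernoff s H.P (q s))
    (hpos : ∀ s ∈ Set.Ioo a 1, 0 < chernoff s H.P (q s))
    (hcont : ContinuousOn (fun s => chernoffSlope s H.P (q s)) (Set.Ioo a 1)) :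
    DifferentiableOn ℝ (phi H.P H.base) (Set.Ioo a 1) ∧
    Tendsto (psi H.P H.base) (𝓝[>] a) (𝓝 (criticalRate H.P H.base a)) ∧
    ∀ R : ℝ, 0 ≤ R → criticalRate H.P H.base a < R → H.errorExponent R = H.hoeffdingBound a R := by
  have hI : Set.Ioo a 1 ⊆ Set.Ioo 0 1 := Set.Ioo_subset_Ioo_left ha0
  have hqs : ∀ s ∈ Set.Ioo a 1, q s ∈ stdSimplex ℝ X := fun s hs => H.base_subset (hq s hs)
  have hdiv : ∀ s ∈ Set.Ioo a 1, renyiDivSet s H.P H.base =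
      ((Real.log (chernoff s H.P (q s)) / (s - 1) : ℝ) : EReal) := fun s hs => by
    rw [renyiDivSet_eq_of_chernoff_le H.P_mem.1 H.base_subset (hq s hs) (hI hs) (hmax s hs),
      renyiDiv_of_pos H.P_mem.1 (hqs s hs).1 (hI hs) (hpos s hs)]
  set c : ℝ → ℝ := fun s => chernoffSlope s H.P (q s) with hc
  have hphi : ∀ s ∈ Set.Ioo a 1, phi H.P H.base s = Real.log (chernoff s H.P (q s)) :=
    fun s hs => by
      have : s - 1 ≠ 0 := by linarith [hs.2]
      rw [phi, hdiv s hs, EReal.toReal_coe, mul_div_cancel₀ _ this]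
  -- The tangent at `s` lies below `log (chernoff · P (q s))`, which at `t` lies below the maximum
  -- `φ t`.
  have hsub : ∀ s ∈ Set.Ioo a 1, ∀ t ∈ Set.Ioo a 1,
      phi H.P H.base s + (t - s) * c s ≤ phi H.P H.base t := fun s hs t ht => by
    rw [hphi s hs, hphi t ht]
    have h1 := chernoff_mul_exp_le H.P_mem.1 (hqs s hs).1 (hI hs) (hpos s hs) t
    refine (log_chernoff_add_le H.P_mem.1 (hqs s hs).1 (hI hs) (hpos s hs) t).trans
      (Real.log_le_log (lt_of_lt_of_le ?_ h1) (hmax t ht _ (hq s hs)))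
    exact mul_pos (hpos s hs) (Real.exp_pos _)
  have hder : ∀ s ∈ Set.Ioo a 1, HasDerivAt (phi H.P H.base) (c s) s := fun s hs =>
    hasDerivAt_of_subgradient hcont hsub (isOpen_Ioo.mem_nhds hs)
  have hdiff : DifferentiableOn ℝ (phi H.P H.base) (Set.Ioo a 1) := fun s hs =>
    (hder s hs).differentiableAt.differentiableWithinAt
  have hpsi : Set.EqOn (psi H.P H.base) (fun s => s * c s - phi H.P H.base s) (Set.Ioo a 1) :=
    fun s hs => by simp only [psi, (hder s hs).deriv]
  have hpsic : ContinuousOn (psi H.P H.base) (Set.Ioo a 1) :=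
    ((continuousOn_id.mul hcont).sub hdiff.continuousOn).congr hpsi
  have hpsim : MonotoneOn (psi H.P H.base) (Set.Ioo a 1) :=
    (monotoneOn_of_subgradient (fun s hs => (hI hs).1) hsub).congr hpsi.symm
  have hpsi0 : ∀ s ∈ Set.Ioo a 1, 0 ≤ psi H.P H.base s := fun s hs => by
    rw [hpsi hs]
    dsimp only
    rw [hphi s hs]
    exact slope_sub_log_chernoff_nonneg H.P_mem.1 (hqs s hs) (hI hs) (hpos s hs)
  have hlim : Tendsto (psi H.P H.base) (𝓝[>] a) (𝓝 (criticalRate H.P H.base a)) :=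
    tendsto_nhds_limUnder (exists_tendsto_nhdsGT ha1 hpsim hpsi0)
  refine ⟨hdiff, hlim, fun R hR hRc => le_antisymm ?_ (hle R)⟩
  obtain ⟨s₀, hψ₀, hs₀⟩ :=
    ((hlim.eventually (gt_mem_nhds hRc)).and (Ioo_mem_nhdsGT ha1)).exists
  refine le_of_forall_gt fun y hy => ?_
  obtain ⟨b, hb, hby⟩ := EReal.lt_iff_exists_real_btwn.mp hy
  refine lt_of_le_of_lt (EReal_le_coe_of_forall_le_add fun ε hε => ?_) hby
  obtain ⟨s, hs, hsR, hsε⟩ := exists_order_near ha0 hR hpsic hpsim hpsi0 hs₀ hψ₀ hε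
  have hψs : psi H.P H.base s =
      s * chernoffSlope s H.P (q s) - Real.log (chernoff s H.P (q s)) := by
    rw [hpsi hs]
    dsimp only
    rw [hphi s hs]
  have hs0 : s ≠ 0 := (hI hs).1.ne'
  have hs1 : s - 1 ≠ 0 := by linarith [hs.2]
  have hbound : (1 - s) / s * (Real.log (chernoff s H.P (q s)) / (s - 1) - R) ≤ b := by
    rw [← EReal.coe_le_coe_iff]
    refine le_trans (le_of_eq ?_) ((le_iSup₂ (f := fun s (_ : s ∈ Set.Ioo a 1) =>
      (((1 - s) / s : ℝ) : EReal) * (renyiDivSet s H.P H.base - (R : EReal))) s hs).trans hb.le)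
    rw [hdiv s hs]
    push_cast
    rfl
  refine (H.errorExponent_le hprod (hq s hs) (hqs s hs).1 (hI hs) (hpos s hs)
    (hψs ▸ hsR)).trans (EReal.coe_le_coe_iff.mpr ?_)
  rw [hψs] at hsε
  -- The identity `-log G - (1-s)c = (1-s)/s * (log G/(s-1) - R) + (1-s)(R - ψ s)/s`, with `ψ s = s
  -- c - log G`.
  refine le_trans (le_of_eq ?_) (add_le_add hbound hsε)
  field_simp
  ring

end Main

end CompositeTesting

theorem theorem1 {X : Type*} [Fintype X] (H : CompositeTesting.Problem X) (a : ℝ)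
    (ha0 : 0 ≤ a) (ha1 : a < 1)
    (hprod : H.ProductAxiom)
    (hadd : H.AdditivityAxiom (Set.Ioc a 1))
    (huniv : H.UniversalAxiom (Set.Ioc a 1))
    (hpara : H.ConvexParamAxiom (Set.Ioc a 1)) :
    -- the inequality, for every rate
    (∀ R : ℝ, 0 ≤ R → H.hoeffdingBound a R ≤ H.errorExponent R) ∧
    -- the `a`-critical rate is well defined
    DifferentiableOn ℝ (CompositeTesting.phi H.P H.base) (Set.Ioo a 1) ∧
    Tendsto (CompositeTesting.psi H.P H.base) (𝓝[>] a)
      (𝓝 (CompositeTesting.criticalRate H.P H.base a)) ∧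
    -- equality above the `a`-critical rate
    (∀ R : ℝ, 0 ≤ R → CompositeTesting.criticalRate H.P H.base a < R →
      H.errorExponent R = H.hoeffdingBound a R) := by
  have hle := H.hoeffdingBound_le_errorExponent ha0 hadd huniv
  obtain ⟨d, Θ, Q, hΘ, -, hC2, hbase, -, -, hmin⟩ := hpara
  have hI : Set.Ioo a 1 ⊆ Set.Ioo 0 1 := Set.Ioo_subset_Ioo_left ha0
  have hQb : ∀ θ ∈ Θ, Q θ ∈ H.base := fun θ hθ => hbase ▸ ⟨θ, hθ, rfl⟩
  have hQ : ∀ θ ∈ Θ, 0 ≤ Q θ := fun θ hθ => (H.base_subset (hQb θ hθ)).1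
  have hP := H.P_mem.1
  refine ⟨fun R _ => hle R, ?_⟩
  -- If some `Q θ` overlaps the support of `P`, every maximal Chernoff sum is positive; otherwise
  -- all divergences are infinite.
  by_cases hsupp : ∃ θ ∈ Θ, ∃ x, 0 < H.P x ∧ 0 < Q θ x
  · obtain ⟨θ₁, hθ₁, hx⟩ := hsupp
    choose! τ hτ hτmin using fun s (hs : s ∈ Set.Ioo a 1) => hmin s ⟨hs.1, hs.2.le⟩
    have hτΘ : ∀ s ∈ Set.Ioo a 1, τ s ∈ Θ := fun s hs => interior_subset (hτ s hs)
    have hlt : ∀ s ∈ Set.Ioo a 1, ∀ θ ∈ Θ, θ ≠ τ s →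
        CompositeTesting.chernoff s H.P (Q θ) < CompositeTesting.chernoff s H.P (Q (τ s)) := by
      intro s hs θ hθ hne
      -- Since `1/(s-1) < 0`, the unique minimizer of the divergence is the unique maximizer of the
      -- Chernoff sum.
      by_contra! hge
      exact (hτmin s hs θ hθ hne).not_ge (CompositeTesting.renyiDiv_le_renyiDiv hP
        (hQ _ (hτΘ s hs)) (hQ θ hθ) (hI hs) hge)
    have hmax : ∀ s ∈ Set.Ioo a 1, ∀ θ ∈ Θ,
        CompositeTesting.chernoff s H.P (Q θ) ≤ CompositeTesting.chernoff s H.P (Q (τ s)) := by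
      intro s hs θ hθ
      by_cases h : θ = τ s
      · rw [h]
      · exact (hlt s hs θ hθ h).le
    have hpos : ∀ s ∈ Set.Ioo a 1, 0 < CompositeTesting.chernoff s H.P (Q (τ s)) := fun s hs =>
      ((CompositeTesting.chernoff_pos_iff hP (hQ θ₁ hθ₁) (hI hs)).mpr hx).trans_le
        (hmax s hs θ₁ hθ₁)
    refine H.errorExponent_eq_of_argmax ha0 ha1 hle hprod (q := fun s => Q (τ s))
      (fun s hs => hQb _ (hτΘ s hs)) (fun s hs q' hq' => ?_) hpos
      (CompositeTesting.continuousOn_chernoffSlope_argmax hI hC2.continuousOn hQ hτΘ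
        (CompositeTesting.continuousOn_argmax hI hΘ hC2.continuousOn hτΘ hlt) hpos)
    obtain ⟨θ, hθ, rfl⟩ := hbase ▸ hq'
    exact hmax s hs θ hθ
  · have htop : ∀ s ∈ Set.Ioo a 1, CompositeTesting.renyiDivSet s H.P H.base = ⊤ := by
      intro s hs
      refine top_le_iff.mp (le_iInf₂ fun q hq => ?_)
      obtain ⟨θ, hθ, rfl⟩ := hbase ▸ hq
      rw [CompositeTesting.renyiDiv_of_eq_zero hP (hQ θ hθ) (hI hs)]
      refine le_antisymm (not_lt.mp fun h => hsupp ⟨θ, hθ, ?_⟩)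
        (CompositeTesting.chernoff_nonneg hP (hQ θ hθ) s)
      exact (CompositeTesting.chernoff_pos_iff hP (hQ θ hθ) (hI hs)).mp h
    obtain ⟨h1, h2, h3⟩ := H.errorExponent_eq_of_divergence_top ha0 ha1 hle htop
    exact ⟨h1, h2, fun R _ _ => h3 R⟩
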